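/- Let $\mathbb{F}_q$ be a finite field with primitive element $\alpha$, let $\mathcal{C}\subseteq\mathbb{F}_q^n$ be a linear code, let $\mathbb{K}$ be a field, and let $\mathbb{K}[\mathbf{x}]$ be the polynomial ring in the $n(q-1)$ variables $x_{ij}$, $1\le i\le n$, $1\le j\le q-1$. For $a\in\mathbb{F}_q^n$ let $\blacktriangle a\in\mathbb{N}_0^{n(q-1)}$ be the vector whose $(i,j)$ entry is $1$ if $a_i=\alpha^j$ and $0$ otherwise; for $u\in\mathbb{N}_0^{n(q-1)}$ let $\blacktriangledown u\in\mathbb{F}_q^n$ be the vector with coordinates $(\blacktriangledown u)_i=\sum_{j=1}^{q-1}u_{ij}\alpha^j$, and let $\mathrm{Cos}(u)=\{v\in\mathbb{N}_0^{n(q-1)}\mid\blacktriangledown u-\blacktriangledown v\in\mathcal{C}\}$. Let $I_+(\mathcal{C})$ be the generalized code ideal $\langle \mathbf{x}^{\blacktriangle a}-\mathbf{x}^{\blacktriangle b}\mid a,b\in\mathbb{F}_q^n,\ a-b\in\mathcal{C}\rangle$ of $\mathbb{K}[\mathbf{x}]$. (The statement is claimed both for this ideal and for its sum with the ideal $I_q$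 generated, for $1\le i\le n$, by all $x_{ij}x_{ik}-x_{il}$ with $\alpha^j+\alpha^k=\alpha^l$ and all $x_{ij}x_{ik}-1$ with $\alpha^j+\alpha^k=0$; the two ideals are equal if no coordinate vanishes identically on $\mathcal{C}$.) A pure binomial is a polynomial $\mathbf{x}^u-\mathbf{x}^{u'}$ with $u\neq u'$ and $\mathbf{x}^u,\mathbf{x}^{u'}$ relatively prime. A pure binomial $\mathbf{x}^u-\mathbf{x}^{u'}$ in an ideal $I$ is primitive if there is no other pure binomial $\mathbf{x}^a-\mathbf{x}^b$ in $I$ such that $\mathbf{x}^a$ divides $\mathbf{x}^u$ and $\mathbf{x}^b$ divides $\mathbf{x}^{u'}$. The universal Gröbner basis of $I$ is the union of the reduced Gröbner bases of $I$ with respect to all monomial orders. Lemma. Let $\mathbf{x}^u-\mathbf{x}^{u'}$ be a primitive binomial in $I_+(\mathcal{C})$ with $u,u'\neq\mathbf{0}$. If there is a vector $\omega\in\mathbb{R}^{n(q-1)}$ with non-negative entries such that $$\omega\cdot u'\le\omega\cdot u<\omega\cdot v\qquad\text{for all } v\in\mathrm{Cos}(u)\setminus\{u,u'\},$$ then $\mathbf{x}^u-\mathbf{x}^{u'}$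 belongs to the universal Gröbner basis of $I_+(\mathcal{C})$. -/

import Mathlib

open MvPolynomial

noncomputable section

/-! ### Reduced and universal Gröbner bases -/

/-- The leading ideal of `I` with respect to the monomial order `m`. -/
def leadingIdeal {σ : Type} {K : Type*} [Field K] (m : MonomialOrder.{0, 0} σ)
    (I : Ideal (MvPolynomial σ K)) : Ideal (MvPolynomial σ K) :=
  Ideal.span (m.leadingTerm '' (I : Set (MvPolynomial σ K)))

/-- `G` is a Gröbner basis of `I`: a finite subset of `I` whose leading terms generate the
leading ideal of `I`. -/
structure IsGroebnerBasis {σ : Type} {K : Type*} [Field K] (m : MonomialOrder.{0, 0} σ)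
    (G : Set (MvPolynomial σ K)) (I : Ideal (MvPolynomial σ K)) : Prop where
  finite : G.Finite
  subset : G ⊆ (I : Set (MvPolynomial σ K))
  span_leadingTerm : Ideal.span (m.leadingTerm '' G) = leadingIdeal m I

/-- `G` is the reduced Gröbner basis of `I`: a Gröbner basis of monic polynomials such that no
monomial occurring in an element `g` of `G` is divisible by the leading monomial of another
element of `G`. -/
structure IsReducedGroebnerBasis {σ : Type} {K : Type*} [Field K] (m : MonomialOrder.{0, 0} σ)
    (G : Set (MvPolynomial σ K)) (I : Ideal (MvPolynomial σ K)) : Prop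
    extends IsGroebnerBasis m G I where
  monic : ∀ g ∈ G, m.Monic g
  reduced : ∀ g ∈ G, ∀ a ∈ g.support, ∀ h ∈ G, h ≠ g → ¬ m.degree h ≤ a

/-- The universal Gröbner basis of `I`: the union of all reduced Gröbner bases of `I`, taken over
all monomial orders. The variables are indexed by a type in the lowest universe, and every
monomial order on them is isomorphic to one whose carrier is in the lowest universe. -/
def universalGroebnerBasis {σ : Type} {K : Type*} [Field K]
    (I : Ideal (MvPolynomial σ K)) : Set (MvPolynomial σ K) :=
  {f | ∃ (m : MonomialOrder.{0, 0} σ) (G : Set (MvPolynomial σ K)),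
    IsReducedGroebnerBasis m G I ∧ f ∈ G}

/-! ### Primitive binomials -/

/-- The polynomial `x ^ u - x ^ v`. -/
def binom {σ : Type} (K : Type*) [Field K] (u v : σ →₀ ℕ) : MvPolynomial σ K :=
  monomial u 1 - monomial v 1

/-- `x ^ u - x ^ v` is a pure binomial: it has two different terms, whose monomials are relatively
prime. -/
def IsPureBinomial {σ : Type} (u v : σ →₀ ℕ) : Prop :=
  u ≠ v ∧ Disjoint u.support v.support

/-- `x ^ u - x ^ v` is a primitive binomial of `I`: a pure binomial in `I` such that there is no
other pure binomial `x ^ a - x ^ b` in `I` with `x ^ a ∣ x ^ u` and `x ^ b ∣ x ^ v`. -/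
def IsPrimitiveBinomial {σ : Type} {K : Type*} [Field K] (I : Ideal (MvPolynomial σ K))
    (u v : σ →₀ ℕ) : Prop :=
  IsPureBinomial u v ∧ binom K u v ∈ I ∧
    ∀ a b : σ →₀ ℕ, IsPureBinomial a b → binom K a b ∈ I → a ≤ u → b ≤ v → a = u ∧ b = v

/-! ### Generalized code ideals

The variables are indexed by the pairs `(i, j)` with `i : Fin n` and `j : Fin (q - 1)`, where `q`
is the cardinality of `F`. Indices start at zero: `(i, j)` belongs to the `i`-th coordinate and
to the power `α ^ (j + 1)` of the primitive element `α`. -/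

/-- The index set of the `n (q - 1)` variables. -/
abbrev CodeVar (F : Type*) [Fintype F] (n : ℕ) : Type :=
  Fin n × Fin (Fintype.card F - 1)

open Classical in
/-- The crossing map: a nonzero coordinate `α ^ (j + 1)` is sent to the unit vector with index `j`,
a zero coordinate to the zero vector. -/
def crossing {F : Type*} [Field F] [Fintype F] {n : ℕ} (α : F) (a : Fin n → F) :
    CodeVar F n →₀ ℕ :=
  Finsupp.equivFunOnFinite.symm fun s => if a s.1 = α ^ ((s.2 : ℕ) + 1) then 1 else 0

/-- The associated map in the other direction, on exponent vectors. -/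
def uncrossing {F : Type*} [Field F] [Fintype F] {n : ℕ} (α : F) (u : CodeVar F n →₀ ℕ) :
    Fin n → F :=
  fun i => ∑ j : Fin (Fintype.card F - 1), (u (i, j) : F) * α ^ ((j : ℕ) + 1)

/-- The ideal generated by the `x ^ ▲a - x ^ ▲b` with `a - b ∈ C`, where `▲` is the crossing
map. -/
def genCodeIdeal (K : Type*) [Field K] {F : Type*} [Field F] [Fintype F] {n : ℕ} (α : F)
    (C : Submodule F (Fin n → F)) : Ideal (MvPolynomial (CodeVar F n) K) :=
  Ideal.span {f | ∃ a b : Fin n → F, a - b ∈ C ∧ f = binom K (crossing α a) (crossing α b)}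

/-- The ideal `I_q`, which encodes the additive structure of the field `F` in each coordinate. -/
def additiveIdeal (K : Type*) [Field K] {F : Type*} [Field F] [Fintype F] (n : ℕ) (α : F) :
    Ideal (MvPolynomial (CodeVar F n) K) :=
  Ideal.span
    ({f | ∃ (i : Fin n) (a b c : Fin (Fintype.card F - 1)),
        α ^ ((a : ℕ) + 1) + α ^ ((b : ℕ) + 1) = α ^ ((c : ℕ) + 1) ∧
          f = X (i, a) * X (i, b) - X (i, c)} ∪
      {f | ∃ (i : Fin n) (a b : Fin (Fintype.card F - 1)),
        α ^ ((a : ℕ) + 1) + α ^ ((b : ℕ) + 1) = 0 ∧ f = X (i, a) * X (i, b) - 1})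

/-- The set `Cos u` of all exponent vectors `v` such that `▽u - ▽v` is a codeword, where `▽` is
the map `uncrossing`. -/
def Cos {F : Type*} [Field F] [Fintype F] {n : ℕ} (α : F) (C : Submodule F (Fin n → F))
    (u : CodeVar F n →₀ ℕ) : Set (CodeVar F n →₀ ℕ) :=
  {v | uncrossing α u - uncrossing α v ∈ C}

/-- The inner product `ω · u` of a weight vector with an exponent vector. -/
def weight {σ : Type} [Fintype σ] (ω : σ → ℝ) (u : σ →₀ ℕ) : ℝ :=
  ∑ s, ω s * (u s : ℝ)

end

/-! Grade monomials by the class of `▽u` modulo `C`. Both ideals lie in the kernel of the induced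
map to the group algebra of `F ^ n / C`, so every monomial of a nonzero `g ∈ I` shares its class
with another monomial of `g`; hence a leading exponent is never the `m`-least of its class. Choose
`m` refining `ω` with `u'` below `u`. By the weight hypothesis, `u'` is then the only exponent of
the class of `u` below `u`. If a leading exponent `d` divides `u`, replacing `d` by a smaller `w` of
its class gives `u - d + w = u'`, so `u - d` divides both coprime monomials and `d = u`. If `d`
divides `u'`, the same replacement gives an element of the class below `u'`, which is impossible. So
the leading term is minimal and the tail standard, which places the binomial in the reduced Gröbner
basis. -/

open scoped MonomialOrder

/-! ### Monomial orders refining a weight. -/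

section RefineByWeight

variable {σ : Type}

/-- Pairing an additive weight with the embedding into the synonym type of a monomial order. -/
noncomputable def weightProdToSyn (m : MonomialOrder.{0, 0} σ) (w : (σ →₀ ℕ) →+ ℝ) :
    (σ →₀ ℕ) →+ ℝ ×ₗ m.syn where
  toFun a := toLex (w a, m.toSyn a)
  map_zero' := by simp
  map_add' a b := by simp [← toLex_add]

theorem weightProdToSyn_monotone (m : MonomialOrder.{0, 0} σ) (w : (σ →₀ ℕ) →+ ℝ)
    (hw : Monotone w) : Monotone (weightProdToSyn m w) := by
  intro a b hab
  exact Prod.Lex.toLex_mono ⟨hw hab, m.toSyn_monotone hab⟩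

theorem weightProdToSyn_leftInverse (m : MonomialOrder.{0, 0} σ) (w : (σ →₀ ℕ) →+ ℝ) :
    Function.LeftInverse (fun p : ℝ ×ₗ m.syn => m.toSyn.symm (ofLex p).2)
      (weightProdToSyn m w) := fun a =>
  m.toSyn.symm_apply_apply a

/-- The monomial order that compares weights first and breaks ties by `m`. -/
noncomputable def MonomialOrder.refineByWeight [Finite σ] (m : MonomialOrder.{0, 0} σ) (w : (σ →₀ ℕ) →+ ℝ)
    (hw : Monotone w) : MonomialOrder.{0, 0} σ where
  -- `ℝ ×ₗ m.syn` is not well-founded; only the image of the exponents is.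
  syn := AddMonoidHom.mrange (weightProdToSyn m w)
  toSyn := AddEquiv.ofLeftInverse' (weightProdToSyn m w) (weightProdToSyn_leftInverse m w)
  toSyn_monotone := fun _ _ hab => weightProdToSyn_monotone m w hw hab
  wellFoundedLT_syn := by
    -- Dickson's lemma: a monotone surjection transports the well-quasi-order of `σ →₀ ℕ`.
    have : WellQuasiOrderedLE (AddMonoidHom.mrange (weightProdToSyn m w)) :=
      Monotone.wellQuasiOrderedLE_of_wellQuasiOrderedLE_of_surjective
        (f := AddEquiv.ofLeftInverse' (weightProdToSyn m w) (weightProdToSyn_leftInverse m w))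
        (fun _ _ hab => weightProdToSyn_monotone m w hw hab) (AddEquiv.surjective _)
    infer_instance

theorem MonomialOrder.refineByWeight_lt_iff [Finite σ] (m : MonomialOrder.{0, 0} σ)
    (w : (σ →₀ ℕ) →+ ℝ) (hw : Monotone w) (a b : σ →₀ ℕ) :
    (a ≺[m.refineByWeight w hw] b) ↔ w a < w b ∨ w a = w b ∧ a ≺[m] b := by
  change toLex (w a, m.toSyn a) < toLex (w b, m.toSyn b) ↔ _
  simp [Prod.Lex.toLex_lt_toLex]

/-- The weight of an exponent vector as an additive map. -/
def weightHom [Fintype σ] (ω : σ → ℝ) : (σ →₀ ℕ) →+ ℝ where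
  toFun := weight ω
  map_zero' := by simp [weight]
  map_add' a b := by simp [weight, mul_add, Finset.sum_add_distrib]

theorem weightHom_monotone [Fintype σ] {ω : σ → ℝ} (hω : ∀ s, 0 ≤ ω s) :
    Monotone (weightHom ω) := fun _ _ hab =>
  Finset.sum_le_sum fun s _ => mul_le_mul_of_nonneg_left (Nat.cast_le.2 (hab s)) (hω s)

/-- A monomial order exists on any finite set of variables. -/
theorem MonomialOrder.nonempty_of_finite [Finite σ] : Nonempty (MonomialOrder.{0, 0} σ) := by
  obtain ⟨k, ⟨e⟩⟩ := Finite.exists_equiv_fin σ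
  let _ : LinearOrder σ := LinearOrder.lift' e e.injective
  exact ⟨MonomialOrder.lex⟩

/-- Given a nonnegative weight and coprime monomials `x ^ u ≠ 1` and `x ^ v` with the weight of
`v` at most the one of `u`, there is a monomial order refining the weight with `v` below `u`. -/
theorem exists_monomialOrder_refining_weight [Fintype σ] {ω : σ → ℝ} (hω : ∀ s, 0 ≤ ω s)
    {u v : σ →₀ ℕ} (hu : u ≠ 0) (hdisj : Disjoint u.support v.support)
    (hle : weight ω v ≤ weight ω u) :
    ∃ m : MonomialOrder.{0, 0} σ, (v ≺[m] u) ∧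
      ∀ a b : σ →₀ ℕ, (a ≺[m] b) → weight ω a ≤ weight ω b := by
  classical
  obtain ⟨m₀⟩ := MonomialOrder.nonempty_of_finite (σ := σ)
  -- Tie-breaker: the indicator weight of the support of `u` vanishes on the coprime `v` and is
  -- positive on `u`.
  let χ : σ → ℝ := fun s => if s ∈ u.support then 1 else 0
  have hχ : ∀ s, 0 ≤ χ s := fun s => by dsimp only [χ]; split_ifs <;> norm_num
  refine ⟨(m₀.refineByWeight (weightHom χ) (weightHom_monotone hχ)).refineByWeight
    (weightHom ω) (weightHom_monotone hω), ?_, ?_⟩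
  · rw [MonomialOrder.refineByWeight_lt_iff, MonomialOrder.refineByWeight_lt_iff]
    refine hle.lt_or_eq.imp id fun h => ⟨h, Or.inl ?_⟩
    have hv : weight χ v = 0 := Finset.sum_eq_zero fun s _ => by
      by_cases hs : s ∈ u.support
      · simp [Finsupp.notMem_support_iff.1 (Finset.disjoint_left.1 hdisj hs)]
      · simp only [χ, if_neg hs, zero_mul]
    obtain ⟨s, hs⟩ := Finsupp.support_nonempty_iff.2 hu
    have hpos : 0 < weight χ u :=
      Finset.sum_pos' (fun t _ => mul_nonneg (hχ t) (Nat.cast_nonneg _))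
        ⟨s, Finset.mem_univ _, by
          simp only [χ, if_pos hs, one_mul]
          exact Nat.cast_pos.2 (Nat.pos_of_ne_zero (Finsupp.mem_support_iff.1 hs))⟩
    exact hv.trans_lt hpos
  · intro a b h
    rw [MonomialOrder.refineByWeight_lt_iff] at h
    exact h.elim le_of_lt fun h => h.1.le

end RefineByWeight

/-! ### Construction of reduced Gröbner bases. -/

section ReducedGroebnerBasis

variable {σ : Type} {K : Type*} [Field K]

/-- Every leading exponent `s` of `I` that is minimal for divisibility is the leading exponent of
a monic element of `I` whose other exponents are standard. -/
theorem exists_monic_mem_of_minimal_degree (m : MonomialOrder.{0, 0} σ)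
    (I : Ideal (MvPolynomial σ K)) {s : σ →₀ ℕ}
    (hs : ∃ g ∈ I, g ≠ 0 ∧ m.degree g = s) :
    ∃ f ∈ I, m.Monic f ∧ m.degree f = s ∧
      ∀ a ∈ f.support, a ≠ s → ∀ g ∈ I, g ≠ 0 → ¬ m.degree g ≤ a := by
  classical
  -- Dividing `x ^ s` by all nonzero elements of `I` leaves a standard remainder `r`; the required
  -- element is `x ^ s - r`.
  obtain ⟨q, r, hqr, hdeg, hr⟩ := m.div_set (B := {g | g ∈ I ∧ g ≠ 0})
    (fun b hb => (isUnit_iff_ne_zero.2 (m.leadingCoeff_ne_zero_iff.2 hb.2)))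
    (monomial s (1 : K))
  have hmem : Finsupp.linearCombination _
      (fun b : {g | g ∈ I ∧ g ≠ 0} => (b : MvPolynomial σ K)) q ∈ I := by
    rw [Finsupp.linearCombination_apply]
    exact Ideal.sum_mem _ fun b _ => I.mul_mem_left _ b.2.1
  set f := Finsupp.linearCombination _
      (fun b : {g | g ∈ I ∧ g ≠ 0} => (b : MvPolynomial σ K)) q with hf
  have hfr : f = monomial s 1 - r := eq_sub_of_add_eq hqr.symm
  have hsr : s ∉ r.support := by
    intro h
    obtain ⟨g, hg, hg0, rfl⟩ := hs
    exact hr _ h g ⟨hg, hg0⟩ le_rfl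
  have hcoeff : f.coeff s = 1 := by
    rw [hfr, coeff_sub, coeff_monomial, if_pos rfl, notMem_support_iff.1 hsr, sub_zero]
  have hfle : m.degree f ≼[m] s := by
    rw [hf, Finsupp.linearCombination_apply]
    refine m.degree_sum_le.trans (Finset.sup_le fun b _ => ?_)
    have := hdeg b
    rw [m.degree_monomial, if_neg one_ne_zero] at this
    dsimp only
    rwa [smul_eq_mul, mul_comm]
  have hfs : m.degree f = s := m.toSyn.injective <| le_antisymm hfle <|
    m.le_degree (mem_support_iff.2 (hcoeff ▸ one_ne_zero))
  refine ⟨f, hmem, ?_, hfs, fun a ha has g hg hg0 => hr a ?_ g ⟨hg, hg0⟩⟩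
  · rw [MonomialOrder.Monic, MonomialOrder.leadingCoeff, hfs, hcoeff]
  · rw [mem_support_iff, hfr, coeff_sub, coeff_monomial, if_neg (Ne.symm has), zero_sub,
      neg_ne_zero] at ha
    exact mem_support_iff.2 ha

/-- A monic element of `I` whose leading exponent is minimal among those of `I` and whose other
exponents are standard belongs to a reduced Gröbner basis of `I`. -/
theorem exists_isReducedGroebnerBasis_mem [Finite σ] (m : MonomialOrder.{0, 0} σ)
    (I : Ideal (MvPolynomial σ K)) {f : MvPolynomial σ K} (hf : f ∈ I) (hmonic : m.Monic f)
    (hmin : ∀ g ∈ I, g ≠ 0 → m.degree g ≤ m.degree f → m.degree g = m.degree f)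
    (hstd : ∀ a ∈ f.support, a ≠ m.degree f → ∀ g ∈ I, g ≠ 0 → ¬ m.degree g ≤ a) :
    ∃ G, IsReducedGroebnerBasis m G I ∧ f ∈ G := by
  classical
  let L : Set (σ →₀ ℕ) := {s | ∃ g ∈ I, g ≠ 0 ∧ m.degree g = s}
  let M : Set (σ →₀ ℕ) := {s | Minimal (· ∈ L) s}
  have hMfin : M.Finite := WellQuasiOrderedLE.finite_of_isAntichain
    (setOfPred_minimal_antichain _)
  have hex : ∀ s, s ∈ L → ∃ h ∈ I, m.Monic h ∧ m.degree h = s ∧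
      ∀ a ∈ h.support, a ≠ s → ∀ g ∈ I, g ≠ 0 → ¬ m.degree g ≤ a :=
    fun s hs => exists_monic_mem_of_minimal_degree m I hs
  choose! p hpI hpmonic hpdeg hpstd using hex
  -- Forcing `f` in at its own exponent avoids proving uniqueness of the chosen elements.
  let b : (σ →₀ ℕ) → MvPolynomial σ K := fun s => if s = m.degree f then f else p s
  have hb : ∀ s ∈ L, b s ∈ I ∧ m.Monic (b s) ∧ m.degree (b s) = s ∧
      ∀ a ∈ (b s).support, a ≠ s → ∀ g ∈ I, g ≠ 0 → ¬ m.degree g ≤ a := by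
    intro s hs
    by_cases h : s = m.degree f
    · subst h
      rw [show b (m.degree f) = f from if_pos rfl]
      exact ⟨hf, hmonic, rfl, hstd⟩
    · simp only [b, if_neg h]
      exact ⟨hpI s hs, hpmonic s hs, hpdeg s hs, hpstd s hs⟩
  have hfM : m.degree f ∈ M := by
    refine ⟨⟨f, hf, hmonic.ne_zero, rfl⟩, ?_⟩
    rintro _ ⟨g, hg, hg0, rfl⟩ hle
    exact (hmin g hg hg0 hle).ge
  refine ⟨b '' M, ⟨⟨hMfin.image b, ?_, ?_⟩, ?_, ?_⟩, m.degree f, hfM, by simp [b]⟩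
  · rintro _ ⟨s, hs, rfl⟩
    exact (hb s hs.1).1
  · refine le_antisymm (Ideal.span_mono (Set.image_mono ?_)) (Ideal.span_le.2 ?_)
    · rintro _ ⟨s, hs, rfl⟩
      exact (hb s hs.1).1
    · rintro _ ⟨g, hg, rfl⟩
      by_cases hg0 : g = 0
      · simp [hg0]
      obtain ⟨s, hle, hs⟩ := exists_minimal_le_of_wellFoundedLT (· ∈ L) (m.degree g)
        ⟨g, hg, hg0, rfl⟩
      obtain ⟨-, h2, h3, -⟩ := hb s hs.1
      have hlt : m.leadingTerm (b s) = monomial s 1 := by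
        rw [MonomialOrder.leadingTerm, h3, h2.leadingCoeff_eq_one]
      have : m.leadingTerm g =
          monomial (m.degree g - s) (m.leadingCoeff g) * m.leadingTerm (b s) := by
        rw [hlt, monomial_mul, tsub_add_cancel_of_le hle, mul_one]
        rfl
      rw [SetLike.mem_coe, this]
      exact Ideal.mul_mem_left _ _ (Ideal.subset_span ⟨_, ⟨s, hs, rfl⟩, rfl⟩)
  · rintro _ ⟨s, hs, rfl⟩
    exact (hb s hs.1).2.1
  · rintro _ ⟨s, hs, rfl⟩ a ha _ ⟨t, ht, rfl⟩ hne hle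
    by_cases has : a = s
    · subst has
      rw [(hb t ht.1).2.2.1] at hle
      exact hne (by rw [le_antisymm hle (hs.2 ht.1 hle)])
    · exact (hb s hs.1).2.2.2 a ha has _ (hb t ht.1).1 (hb t ht.1).2.1.ne_zero hle

end ReducedGroebnerBasis

/-! ### Gradings and group algebras. -/

section Grading

variable {σ : Type} {K : Type*} [Field K] {A : Type*} [AddCommGroup A]

/-- The ring homomorphism to the group algebra of `A` induced by a grading of the monomials. -/
noncomputable def gradingHom (K : Type*) [Field K] (φ : (σ →₀ ℕ) →+ A) :
    MvPolynomial σ K →+* AddMonoidAlgebra K A :=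
  AddMonoidAlgebra.mapDomainRingHom K φ

theorem gradingHom_monomial (φ : (σ →₀ ℕ) →+ A) (a : σ →₀ ℕ) (c : K) :
    gradingHom K φ (monomial a c) = AddMonoidAlgebra.single (φ a) c :=
  AddMonoidAlgebra.mapDomain_single

/-- In a polynomial killed by `gradingHom`, no monomial is alone in its degree. -/
theorem exists_ne_mem_support_of_gradingHom_eq_zero (φ : (σ →₀ ℕ) →+ A) {f : MvPolynomial σ K}
    (hf : gradingHom K φ f = 0) {a : σ →₀ ℕ} (ha : a ∈ f.support) :
    ∃ b ∈ f.support, b ≠ a ∧ φ b = φ a := by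
  classical
  by_contra! h
  -- If `a` were alone in its degree, this coefficient would be the nonzero coefficient of `f` at
  -- `a`.
  have h0 : (gradingHom K φ f).coeff (φ a) = 0 := by rw [hf]; simp
  rw [f.as_sum, map_sum, AddMonoidAlgebra.coeff_sum, Finsupp.finsetSum_apply,
    Finset.sum_eq_single a] at h0
  · rw [gradingHom_monomial] at h0
    exact mem_support_iff.1 ha (by simpa using h0)
  · intro b hb hba
    rw [gradingHom_monomial]
    simp [h b hb hba]
  · exact fun h' => absurd ha h'

theorem gradingHom_binom (φ : (σ →₀ ℕ) →+ A) (a b : σ →₀ ℕ) (h : φ a = φ b) :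
    gradingHom K φ (binom K a b) = 0 := by
  rw [binom, map_sub, gradingHom_monomial, gradingHom_monomial, h, sub_self]

end Grading

/-! ### The syndrome grading of the code ideals. -/

section Code

variable {F : Type*} [Field F] [Fintype F] {n : ℕ}

theorem exists_eq_pow_succ {α : F} (hα : IsPrimitiveRoot α (Fintype.card F - 1)) {x : F}
    (hx : x ≠ 0) : ∃ j : Fin (Fintype.card F - 1), x = α ^ ((j : ℕ) + 1) := by
  have hcard : 0 < Fintype.card F - 1 := Nat.sub_pos_of_lt Fintype.one_lt_card
  have : NeZero (Fintype.card F - 1) := ⟨hcard.ne'⟩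
  have hα0 : α ≠ 0 := hα.ne_zero hcard.ne'
  -- Dividing by `α` accounts for the exponents starting at `1`.
  obtain ⟨i, hi, h⟩ := hα.eq_pow_of_pow_eq_one
    (ξ := x * α⁻¹) (FiniteField.pow_card_sub_one_eq_one _ (mul_ne_zero hx (inv_ne_zero hα0)))
  exact ⟨⟨i, hi⟩, by rw [pow_succ, h, inv_mul_cancel_right₀ hα0]⟩

theorem pow_succ_injective {α : F} (hα : IsPrimitiveRoot α (Fintype.card F - 1)) :
    Function.Injective fun j : Fin (Fintype.card F - 1) => α ^ ((j : ℕ) + 1) := by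
  intro i j h
  have hα0 : α ≠ 0 := hα.ne_zero (Nat.sub_pos_of_lt Fintype.one_lt_card).ne'
  simp only [pow_succ] at h
  exact Fin.ext (hα.pow_inj i.2 j.2 (mul_right_cancel₀ hα0 h))

theorem uncrossing_crossing {α : F} (hα : IsPrimitiveRoot α (Fintype.card F - 1))
    (a : Fin n → F) : uncrossing α (crossing α a) = a := by
  classical
  have hα0 : α ≠ 0 := hα.ne_zero (Nat.sub_pos_of_lt Fintype.one_lt_card).ne'
  funext i
  simp only [uncrossing, crossing, Finsupp.equivFunOnFinite_symm_apply_apply]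
  by_cases h : a i = 0
  · refine Eq.trans ?_ h.symm
    refine Finset.sum_eq_zero fun j _ => ?_
    rw [if_neg fun h' => pow_ne_zero _ hα0 (h'.symm.trans h), Nat.cast_zero, zero_mul]
  · obtain ⟨j, hj⟩ := exists_eq_pow_succ hα h
    rw [Finset.sum_eq_single j]
    · rw [if_pos hj, Nat.cast_one, one_mul, hj]
    · intro k _ hk
      rw [if_neg fun h' => hk (pow_succ_injective hα (h'.symm.trans hj)), Nat.cast_zero, zero_mul]
    · exact fun h' => absurd (Finset.mem_univ _) h'

/-- The map `uncrossing`, modulo the code. -/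
def syndromeHom (α : F) (C : Submodule F (Fin n → F)) :
    (CodeVar F n →₀ ℕ) →+ (Fin n → F) ⧸ C where
  toFun u := C.mkQ (uncrossing α u)
  map_zero' := by
    rw [show uncrossing α (0 : CodeVar F n →₀ ℕ) = 0 by funext; simp [uncrossing], map_zero]
  map_add' u v := by
    rw [← map_add, show uncrossing α (u + v) = uncrossing α u + uncrossing α v by
      funext; simp [uncrossing, add_mul, Finset.sum_add_distrib]]

theorem syndromeHom_eq_iff (α : F) (C : Submodule F (Fin n → F)) (u v : CodeVar F n →₀ ℕ) :
    syndromeHom α C u = syndromeHom α C v ↔ v ∈ Cos α C u :=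
  Submodule.Quotient.eq C

theorem uncrossing_single (α : F) (i : Fin n) (j : Fin (Fintype.card F - 1)) :
    uncrossing α (Finsupp.single (i, j) 1) = Pi.single i (α ^ ((j : ℕ) + 1)) := by
  classical
  funext k
  rcases eq_or_ne k i with rfl | h
  · simp [uncrossing, Finsupp.single_apply]
  · simp [uncrossing, h]

theorem genCodeIdeal_le_ker (K : Type*) [Field K] {α : F}
    (hα : IsPrimitiveRoot α (Fintype.card F - 1)) (C : Submodule F (Fin n → F)) :
    genCodeIdeal K α C ≤ RingHom.ker (gradingHom K (syndromeHom α C)) := by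
  refine Ideal.span_le.2 ?_
  rintro _ ⟨a, b, hab, rfl⟩
  refine gradingHom_binom _ _ _ ((syndromeHom_eq_iff _ _ _ _).2 ?_)
  simpa [Cos, uncrossing_crossing hα] using hab

theorem additiveIdeal_le_ker (K : Type*) [Field K] (α : F) (C : Submodule F (Fin n → F)) :
    additiveIdeal K n α ≤ RingHom.ker (gradingHom K (syndromeHom α C)) := by
  have hX : ∀ (i : Fin n) (j : Fin (Fintype.card F - 1)),
      gradingHom K (syndromeHom α C) (X (i, j)) =
        AddMonoidAlgebra.single (C.mkQ (Pi.single i (α ^ ((j : ℕ) + 1)))) 1 := fun i j => by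
    rw [X, gradingHom_monomial, ← uncrossing_single]
    rfl
  refine Ideal.span_le.2 ?_
  rintro _ (⟨i, a, b, c, h, rfl⟩ | ⟨i, a, b, h, rfl⟩)
  · rw [SetLike.mem_coe, RingHom.mem_ker, map_sub, map_mul, hX, hX, hX,
      AddMonoidAlgebra.single_mul_single, ← map_add, ← Pi.single_add, h, mul_one, sub_self]
  · rw [SetLike.mem_coe, RingHom.mem_ker, map_sub, map_mul, hX, hX, map_one,
      AddMonoidAlgebra.single_mul_single, ← map_add, ← Pi.single_add, h, mul_one,
      Pi.single_zero, map_zero, AddMonoidAlgebra.one_def, sub_self]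

end Code

/-! ### Leading exponents within a class, and the theorem. -/

/-- The leading exponent of a nonzero element of a graded binomial ideal is not the least one in
its class. -/
theorem exists_lt_degree_of_gradingHom_eq_zero {σ : Type} {K : Type*} [Field K] {A : Type*}
    [AddCommGroup A] (m : MonomialOrder.{0, 0} σ) (φ : (σ →₀ ℕ) →+ A) {g : MvPolynomial σ K}
    (hg : gradingHom K φ g = 0) (hg0 : g ≠ 0) :
    ∃ w, φ w = φ (m.degree g) ∧ w ≺[m] m.degree g := by
  obtain ⟨w, hw, hne, hφ⟩ :=
    exists_ne_mem_support_of_gradingHom_eq_zero φ hg (m.degree_mem_support hg0)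
  exact ⟨w, hφ, lt_of_le_of_ne (m.le_degree hw) fun h => hne (m.toSyn.injective h)⟩

/-- Multiples of leading exponents are not the least ones in their class. -/
theorem exists_lt_of_degree_le {σ : Type} {K : Type*} [Field K] {A : Type*}
    [AddCommGroup A] (m : MonomialOrder.{0, 0} σ) (φ : (σ →₀ ℕ) →+ A) {g : MvPolynomial σ K}
    (hg : gradingHom K φ g = 0) (hg0 : g ≠ 0) {a : σ →₀ ℕ} (ha : m.degree g ≤ a) :
    ∃ w, a - m.degree g ≤ w ∧ φ w = φ a ∧ w ≺[m] a := by
  obtain ⟨w, hφ, hlt⟩ := exists_lt_degree_of_gradingHom_eq_zero m φ hg hg0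
  refine ⟨a - m.degree g + w, le_self_add, ?_, ?_⟩
  · rw [map_add, hφ, ← map_add, tsub_add_cancel_of_le ha]
  · conv_rhs => rw [← tsub_add_cancel_of_le ha]
    rw [map_add, map_add]
    exact add_lt_add_right hlt _

theorem mainTheorem10 {K F : Type*} [Field K] [Field F] [Fintype F] {n : ℕ}
    (α : F) (hα : IsPrimitiveRoot α (Fintype.card F - 1))
    (C : Submodule F (Fin n → F))
    (I : Ideal (MvPolynomial (CodeVar F n) K))
    (hI : I = genCodeIdeal K α C ∨ I = genCodeIdeal K α C ⊔ additiveIdeal K n α)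
    (u u' : CodeVar F n →₀ ℕ) (hu : u ≠ 0) (hu' : u' ≠ 0)
    (hprim : IsPrimitiveBinomial I u u')
    (hω : ∃ ω : CodeVar F n → ℝ, (∀ s, 0 ≤ ω s) ∧
      weight ω u' ≤ weight ω u ∧
      ∀ v ∈ Cos α C u \ {u, u'}, weight ω u < weight ω v) :
    binom K u u' ∈ universalGroebnerBasis I := by
  classical
  obtain ⟨⟨hne, hdisj⟩, hmem, -⟩ := hprim
  obtain ⟨ω, hω0, hle, hlt⟩ := hω
  obtain ⟨m, hm, hmω⟩ := exists_monomialOrder_refining_weight hω0 hu hdisj hle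
  let φ := syndromeHom α C
  have hker : ∀ g ∈ I, gradingHom K φ g = 0 := by
    have : I ≤ RingHom.ker (gradingHom K φ) := by
      rcases hI with rfl | rfl
      · exact genCodeIdeal_le_ker K hα C
      · exact sup_le (genCodeIdeal_le_ker K hα C) (additiveIdeal_le_ker K α C)
    exact fun g hg => this hg
  have hbelow : ∀ w, φ w = φ u → (w ≺[m] u) → w = u' := by
    intro w hw hwu
    by_contra hwu'
    refine (hmω w u hwu).not_gt (hlt w ⟨(syndromeHom_eq_iff α C u w).1 hw.symm, ?_⟩)
    rintro (rfl | h)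
    · exact lt_irrefl _ hwu
    · exact hwu' h
  have hdeglt : m.degree (monomial u' (1 : K)) ≺[m] m.degree (monomial u (1 : K)) := by
    rwa [m.degree_monomial, m.degree_monomial, if_neg one_ne_zero, if_neg one_ne_zero]
  have hdeg : m.degree (binom K u u') = u := by
    rw [binom, m.degree_sub_of_lt hdeglt, m.degree_monomial, if_neg one_ne_zero]
  have hmonic : m.Monic (binom K u u') := by
    rw [MonomialOrder.Monic, binom, m.leadingCoeff_sub_of_lt hdeglt, m.leadingCoeff_monomial]
  -- The leading exponent `u` has a smaller element in its class, which can only be `u'`.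
  have hφ : φ u' = φ u := by
    obtain ⟨w, hw, hwu⟩ :=
      exists_lt_degree_of_gradingHom_eq_zero m φ (hker _ hmem) hmonic.ne_zero
    rw [hdeg] at hw hwu
    rw [← hbelow w hw hwu, hw]
  obtain ⟨G, hG, hfG⟩ := exists_isReducedGroebnerBasis_mem m I hmem hmonic
    (by
      intro g hg hg0 hgle
      rw [hdeg] at hgle ⊢
      obtain ⟨w, hw, hwφ, hwu⟩ := exists_lt_of_degree_le m φ (hker g hg) hg0 hgle
      -- Now `u - m.degree g ≤ u'`, and coprimality forces this difference to be zero.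
      rw [hbelow w hwφ hwu] at hw
      refine le_antisymm hgle fun s => tsub_eq_zero_iff_le.1 ?_
      by_cases hs : s ∈ u.support
      · have := hw s
        rwa [Finsupp.notMem_support_iff.1 (Finset.disjoint_left.1 hdisj hs), nonpos_iff_eq_zero]
          at this
      · simp [Finsupp.notMem_support_iff.1 hs])
    (by
      intro a ha hau g hg hg0 hga
      rw [hdeg] at hau
      have hau' : a = u' := by
        by_contra h
        refine mem_support_iff.1 ha ?_
        rw [binom, coeff_sub, coeff_monomial, coeff_monomial, if_neg (Ne.symm hau),
          if_neg (Ne.symm h), sub_zero]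
      subst hau'
      obtain ⟨w, -, hwφ, hwa⟩ := exists_lt_of_degree_le m φ (hker g hg) hg0 hga
      have := hbelow w (hwφ.trans hφ) (hwa.trans hm)
      exact (this ▸ hwa).false)
  exact ⟨m, G, hG, hfG⟩
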